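/- Call a real function on a finite-dimensional real vector space DC if it is the difference of two convex functions. Let $d\ge 2$ and let $F\subset\mathbb{R}^d$ be a closed set which is either empty or has the property that its distance function $d_F=\operatorname{dist}(\cdot,F)$ is DC on $\mathbb{R}^d$. Then every bounded set $C\subset\partial F$ can be covered by finitely many DC hypersurfaces. Here a set $A\subset\mathbb{R}^d$ is called a DC hypersurface if there exist a unit vector $v\in\mathbb{R}^d$ and a DC function $g$ on the hyperplane $W=(\operatorname{span} v)^\perp$ such that $A=\{w+g(w)v : w\in W\}$. -/

import Mathlib

/-- A real function on a real vector space is DC if it is the difference of two convex functions. -/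
def IsDC {E : Type*} [AddCommGroup E] [Module ℝ E] (f : E → ℝ) : Prop :=
  ∃ g h : E → ℝ, ConvexOn ℝ Set.univ g ∧ ConvexOn ℝ Set.univ h ∧ ∀ x, f x = g x - h x

/-- The system of all subsets of `ℝ^d` that are empty, or nonempty and closed with a DC distance
function. -/
def DCDistanceSets (d : ℕ) : Set (Set (EuclideanSpace ℝ (Fin d))) :=
  {F | F = ∅ ∨ (F.Nonempty ∧ IsClosed F ∧ IsDC (fun x => Metric.infDist x F))}

/-- `A` is a DC hypersurface in `ℝ^d`: for some unit vector `v` and some DC function `g` on the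
hyperplane `W = v^⊥`, we have `A = {w + g(w) v : w ∈ W}`. -/
def IsDCHypersurface {d : ℕ} (A : Set (EuclideanSpace ℝ (Fin d))) : Prop :=
  ∃ (v : EuclideanSpace ℝ (Fin d)) (g : ((Submodule.span ℝ {v})ᗮ : Submodule ℝ _) → ℝ),
    ‖v‖ = 1 ∧ IsDC g ∧
      A = {x | ∃ w : ((Submodule.span ℝ {v})ᗮ : Submodule ℝ _),
        x = (w : EuclideanSpace ℝ (Fin d)) + g w • v}

/-! Write `d_F = g - h` with `g`, `h` convex. If `y ∈ F` is a nearest point to `z ∉ F`, then the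
second difference of `d_F` at `y` along `z - y` is at least `‖z - y‖`, hence so is that of `g`. Such
`y` accumulate at every frontier point, so by continuity and convexity `g` has there a kink of size
at least `1 / d` along some coordinate axis (`exists_secondDifference_ge_of_mem_frontier`). A kink
gives an interval of supporting slopes, which contains two neighbours `α < β` of a fixed grid
(`exists_grid_slope`). Where both slopes support `g`, the two partial infima along the line differ
by `(β - α) t`, with `t` the coordinate along the axis; so `t` is a DC function of the projection
(`exists_isDCHypersurface_superset`). On a bounded set only finitely many grid slopes occur. -/

/-- The symmetric second difference `g (x + u) + g (x - u) - 2 g x`. -/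
def secondDifference {E : Type*} [AddCommGroup E] (g : E → ℝ) (x u : E) : ℝ :=
  g (x + u) + g (x - u) - 2 * g x

theorem secondDifference_neg {E : Type*} [AddCommGroup E] (g : E → ℝ) (x u : E) :
    secondDifference g x (-u) = secondDifference g x u := by
  simp only [secondDifference, sub_neg_eq_add, ← sub_eq_add_neg]
  ring

theorem secondDifference_zero {E : Type*} [AddCommGroup E] (g : E → ℝ) (x : E) : secondDifference g x 0 = 0 := by
  simp only [secondDifference, add_zero, sub_zero]
  ring

/-- The set of points at which a linear function of slope `α` supports `g` along the line of
direction `v`. -/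
def supportedAlong {E : Type*} [AddCommGroup E] [Module ℝ E] (g : E → ℝ) (v : E) (α : ℝ) : Set E :=
  {x | ∀ s : ℝ, g x + α * s ≤ g (x + s • v)}

/-- The partial infimum of `g - α t` along the lines of direction `v`. -/
noncomputable def lineInf {E : Type*} [AddCommGroup E] [Module ℝ E] (g : E → ℝ) (v : E) (α : ℝ)
    (x : E) : ℝ :=
  ⨅ t : ℝ, (g (x + t • v) - α * t)

/-! ### Supporting slopes and partial infima of convex functions -/

section Convex

variable {E : Type*} [AddCommGroup E] [Module ℝ E] {g : E → ℝ}

theorem secondDifference_nonneg (hg : ConvexOn ℝ Set.univ g) (x u : E) :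
    0 ≤ secondDifference g x u := by
  have h := hg.2 (Set.mem_univ (x + u)) (Set.mem_univ (x - u))
    (by norm_num : (0 : ℝ) ≤ 1 / 2) (by norm_num : (0 : ℝ) ≤ 1 / 2) (by norm_num)
  have e : (1 / 2 : ℝ) • (x + u) + (1 / 2 : ℝ) • (x - u) = x := by module
  rw [e] at h
  simp only [smul_eq_mul] at h
  unfold secondDifference
  linarith

theorem convexOn_secondDifference (hg : ConvexOn ℝ Set.univ g) (x : E) :
    ConvexOn ℝ Set.univ (secondDifference g x) := by
  refine ⟨convex_univ, fun u _ w _ a b ha hb hab => ?_⟩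
  have h₁ := hg.2 (Set.mem_univ (x + u)) (Set.mem_univ (x + w)) ha hb hab
  have h₂ := hg.2 (Set.mem_univ (x - u)) (Set.mem_univ (x - w)) ha hb hab
  obtain rfl : b = 1 - a := by linarith
  have e₁ : a • (x + u) + (1 - a) • (x + w) = x + (a • u + (1 - a) • w) := by module
  have e₂ : a • (x - u) + (1 - a) • (x - w) = x - (a • u + (1 - a) • w) := by module
  rw [e₁] at h₁
  rw [e₂] at h₂
  simp only [smul_eq_mul, secondDifference] at *
  linarith

theorem secondDifference_smul_le (hg : ConvexOn ℝ Set.univ g) (x u : E) {c : ℝ} (hc : |c| ≤ 1) :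
    secondDifference g x (c • u) ≤ |c| * secondDifference g x u := by
  have key : secondDifference g x (|c| • u) ≤ |c| * secondDifference g x u := by
    have h := (convexOn_secondDifference hg x).2 (Set.mem_univ u) (Set.mem_univ 0) (abs_nonneg c)
      (sub_nonneg.2 hc) (by ring)
    simpa [secondDifference_zero] using h
  rcases abs_choice c with h | h
  · rwa [h] at key ⊢
  · rw [h] at key
    rw [h, ← secondDifference_neg, ← neg_smul]
    exact key

/-- One supported point bounds every parallel line: average `w + t • v` with the reflection `x + x -
w`. -/
theorem bddBelow_line (hg : ConvexOn ℝ Set.univ g) {v x : E} {α : ℝ}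
    (hx : x ∈ supportedAlong g v α) (w : E) :
    BddBelow (Set.range fun t : ℝ => g (w + t • v) - α * t) := by
  refine ⟨2 * g x - g (x + x - w), ?_⟩
  rintro _ ⟨t, rfl⟩
  have h := hg.2 (Set.mem_univ (w + t • v)) (Set.mem_univ (x + x - w))
    (by norm_num : (0 : ℝ) ≤ 1 / 2) (by norm_num : (0 : ℝ) ≤ 1 / 2) (by norm_num)
  have e : (1 / 2 : ℝ) • (w + t • v) + (1 / 2 : ℝ) • (x + x - w) = x + (t / 2) • v := by module
  rw [e] at h
  simp only [smul_eq_mul] at h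
  have := hx (t / 2)
  simp only
  linarith

theorem convexOn_lineInf (hg : ConvexOn ℝ Set.univ g) {v x : E} {α : ℝ}
    (hx : x ∈ supportedAlong g v α) : ConvexOn ℝ Set.univ (lineInf g v α) := by
  refine ⟨convex_univ, fun u _ w _ a b ha hb hab => ?_⟩
  refine le_of_forall_pos_le_add fun ε hε => ?_
  obtain ⟨s, hs⟩ := exists_lt_of_ciInf_lt
    (show (⨅ t : ℝ, (g (u + t • v) - α * t)) < lineInf g v α u + ε from lt_add_of_pos_right _ hε)
  obtain ⟨t, ht⟩ := exists_lt_of_ciInf_lt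
    (show (⨅ t : ℝ, (g (w + t • v) - α * t)) < lineInf g v α w + ε from lt_add_of_pos_right _ hε)
  have h₁ := ciInf_le (bddBelow_line hg hx (a • u + b • w)) (a * s + b * t)
  have h₂ := hg.2 (Set.mem_univ (u + s • v)) (Set.mem_univ (w + t • v)) ha hb hab
  have e : a • (u + s • v) + b • (w + t • v) = a • u + b • w + (a * s + b * t) • v := by module
  rw [e] at h₂
  have h₃ := mul_le_mul_of_nonneg_left hs.le ha
  have h₄ := mul_le_mul_of_nonneg_left ht.le hb
  simp only [smul_eq_mul] at h₂ ⊢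
  have h₅ : a * ε + b * ε = ε := by rw [← add_mul, hab, one_mul]
  unfold lineInf at *
  linarith

theorem lineInf_eq {v w : E} {α t : ℝ} (hx : w + t • v ∈ supportedAlong g v α) :
    lineInf g v α w = g (w + t • v) - α * t := by
  have h : ∀ s : ℝ, g (w + t • v) - α * t ≤ g (w + s • v) - α * s := fun s => by
    have := hx (s - t)
    rw [add_assoc, ← add_smul, add_sub_cancel] at this
    linarith
  refine le_antisymm (ciInf_le (f := fun s : ℝ => g (w + s • v) - α * s)
    ⟨g (w + t • v) - α * t, ?_⟩ t) (le_ciInf h)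
  rintro _ ⟨s, rfl⟩
  exact h s

theorem exists_grid_slope (hg : ConvexOn ℝ Set.univ g) {x v : E} {η : ℝ} (hη : 0 < η)
    (hx : ∀ s : ℝ, 0 < s → η * s ≤ secondDifference g x (s • v)) :
    ∃ k : ℤ, x ∈ supportedAlong g v (k * (η / 2)) ∧ x ∈ supportedAlong g v ((k + 1) * (η / 2)) := by
  have mono : ∀ r s : ℝ, ∀ u : E, 0 < r → r ≤ s →
      s * (g (x + r • u) - g x) ≤ r * (g (x + s • u) - g x) := fun r s u hr hrs => by
    have hs : 0 < s := hr.trans_le hrs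
    have h := hg.2 (Set.mem_univ (x + s • u)) (Set.mem_univ x) (div_nonneg hr.le hs.le)
      (sub_nonneg.2 ((div_le_one hs).2 hrs)) (by ring)
    have e : (r / s) • (x + s • u) + (1 - r / s) • x = x + r • u := by
      rw [smul_add, smul_smul, div_mul_cancel₀ _ hs.ne']
      module
    rw [e] at h
    have := mul_le_mul_of_nonneg_left h hs.le
    have e₂ : s * ((r / s) * g (x + s • u) + (1 - r / s) * g x)
        = r * g (x + s • u) + (s - r) * g x := by
      field_simp
    simp only [smul_eq_mul] at this
    rw [e₂] at this
    linarith
  have gap : ∀ s t : ℝ, 0 < s → 0 < t →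
      -(g (x - t • v) - g x) / t + η ≤ (g (x + s • v) - g x) / s := fun s t hs ht => by
    have hr : 0 < min s t := lt_min hs ht
    have h₁ := mono _ s v hr (min_le_left _ _)
    have h₂ := mono _ t (-v) hr (min_le_right _ _)
    have h₃ := hx _ hr
    simp only [smul_neg, ← sub_eq_add_neg] at h₂
    unfold secondDifference at h₃
    set r := min s t
    have h₄ : (g (x + r • v) - g x) / r ≤ (g (x + s • v) - g x) / s := by
      rw [div_le_div_iff₀ hr hs]; linarith
    have h₅ : (g (x - r • v) - g x) / r ≤ (g (x - t • v) - g x) / t := by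
      rw [div_le_div_iff₀ hr ht]; linarith
    have h₆ : η ≤ (g (x + r • v) - g x) / r + (g (x - r • v) - g x) / r := by
      rw [← add_div, le_div_iff₀ hr]; linarith
    rw [neg_div]
    linarith
  let f : Set.Ioi (0 : ℝ) → ℝ := fun t => -(g (x - (t : ℝ) • v) - g x) / t
  have : Nonempty (Set.Ioi (0 : ℝ)) := ⟨⟨1, Set.mem_Ioi.2 one_pos⟩⟩
  have hb : BddAbove (Set.range f) := by
    refine ⟨(g (x + (1 : ℝ) • v) - g x) / 1, ?_⟩
    rintro _ ⟨t, rfl⟩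
    have := gap 1 t one_pos t.2
    simp only [f]
    linarith
  set m := ⨆ t, f t
  have hlow : ∀ t : ℝ, 0 < t → g x - m * t ≤ g (x - t • v) := fun t ht => by
    have : -(g (x - t • v) - g x) / t ≤ m := le_ciSup hb ⟨t, ht⟩
    rw [div_le_iff₀ ht] at this
    linarith
  have hup : ∀ s : ℝ, 0 < s → g x + (m + η) * s ≤ g (x + s • v) := fun s hs => by
    have : m ≤ (g (x + s • v) - g x) / s - η := ciSup_le fun t => by
      have := gap s t hs t.2
      simp only [f]
      linarith
    have := (le_div_iff₀ hs).1 (show m + η ≤ (g (x + s • v) - g x) / s by linarith)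
    linarith
  have mem : ∀ α : ℝ, m ≤ α → α ≤ m + η → x ∈ supportedAlong g v α := fun α h₁ h₂ s => by
    rcases lt_trichotomy s 0 with hs | rfl | hs
    · have h := hlow (-s) (neg_pos.2 hs)
      rw [neg_smul, sub_neg_eq_add] at h
      have := mul_le_mul_of_nonneg_right h₁ (neg_pos.2 hs).le
      linarith
    · simp
    · have := mul_le_mul_of_nonneg_right h₂ hs.le
      exact le_trans (by linarith) (hup s hs)
  -- With mesh `η / 2`, the first grid point above `m` and its successor both lie in `[m, m + η]`.
  have hη₂ : 0 < η / 2 := half_pos hη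
  have h₁ := (div_le_iff₀ hη₂).1 (Int.le_ceil (m / (η / 2)))
  have h₂ : (⌈m / (η / 2)⌉ : ℝ) * (η / 2) < m + η / 2 := by
    have := mul_lt_mul_of_pos_right (Int.ceil_lt_add_one (m / (η / 2))) hη₂
    rwa [add_mul, one_mul, div_mul_cancel₀ _ hη₂.ne'] at this
  exact ⟨_, mem _ h₁ (by linarith), mem _ (by linarith) (by linarith)⟩

end Convex

/-! ### Kinks at frontier points and the covering hypersurfaces -/

section Euclidean

variable {d : ℕ} {g : EuclideanSpace ℝ (Fin d) → ℝ}

theorem continuous_of_convexOn_univ (hg : ConvexOn ℝ Set.univ g) : Continuous g :=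
  continuousOn_univ.1 (hg.continuousOn isOpen_univ)

theorem exists_isDCHypersurface_superset (hg : ConvexOn ℝ Set.univ g)
    {v : EuclideanSpace ℝ (Fin d)} (hv : ‖v‖ = 1) {α β : ℝ} (hαβ : α < β) :
    ∃ A, IsDCHypersurface A ∧ supportedAlong g v α ∩ supportedAlong g v β ⊆ A := by
  rcases (supportedAlong g v α ∩ supportedAlong g v β).eq_empty_or_nonempty with h | ⟨z, hz⟩
  · rw [h]
    exact ⟨_, ⟨v, fun _ => 0, hv,
      ⟨fun _ => 0, fun _ => 0, convexOn_const _ convex_univ, convexOn_const _ convex_univ,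
        fun _ => by simp⟩, rfl⟩, Set.empty_subset _⟩
  have hpos : 0 ≤ (β - α)⁻¹ := (inv_pos.2 (sub_pos.2 hαβ)).le
  have conv : ∀ γ, z ∈ supportedAlong g v γ → ConvexOn ℝ Set.univ
      (fun w : ((Submodule.span ℝ {v})ᗮ : Submodule ℝ (EuclideanSpace ℝ (Fin d))) =>
        (β - α)⁻¹ * lineInf g v γ w) := fun γ hγ =>
    ((convexOn_lineInf hg hγ).comp_linearMap (Submodule.subtype _)).smul hpos
  refine ⟨_, ⟨v, fun w => (β - α)⁻¹ * lineInf g v α w - (β - α)⁻¹ * lineInf g v β w, hv,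
    ⟨_, _, conv α hz.1, conv β hz.2, fun _ => rfl⟩, rfl⟩, fun x hx => ?_⟩
  have hmem : x - inner ℝ v x • v ∈ (Submodule.span ℝ {v})ᗮ := by
    rw [Submodule.mem_orthogonal_singleton_iff_inner_right, inner_sub_right, inner_smul_right,
      real_inner_self_eq_norm_sq, hv]
    ring
  have e : x - inner ℝ v x • v + (inner ℝ v x : ℝ) • v = x := sub_add_cancel _ _
  refine ⟨⟨_, hmem⟩, ?_⟩
  have h₁ := lineInf_eq (g := g) (w := x - inner ℝ v x • v) (t := inner ℝ v x) (e.symm ▸ hx.1)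
  have h₂ := lineInf_eq (g := g) (w := x - inner ℝ v x • v) (t := inner ℝ v x) (e.symm ▸ hx.2)
  simp only [h₁, h₂]
  have : (β - α)⁻¹ * (g (x - inner ℝ v x • v + inner ℝ v x • v) - α * inner ℝ v x)
      - (β - α)⁻¹ * (g (x - inner ℝ v x • v + inner ℝ v x • v) - β * inner ℝ v x)
      = inner ℝ v x := by
    have := (sub_pos.2 hαβ).ne'
    field_simp
    ring
  rw [this, e]

theorem secondDifference_le_of_forall_single (hg : ConvexOn ℝ Set.univ g) (hd : 0 < d)
    {y u : EuclideanSpace ℝ (Fin d)} (hu : ‖u‖ ≤ 1) {s c : ℝ}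
    (h : ∀ i, secondDifference g y (s • EuclideanSpace.single i 1) < c) :
    secondDifference g y ((s / d) • u) < c := by
  have hd' : (0 : ℝ) < d := Nat.cast_pos.2 hd
  -- The factor `1 / d` makes the vector an average of its axis components, so Jensen applies.
  have e : (s / d) • u = ∑ i : Fin d, (1 / d : ℝ) • (u i • s • EuclideanSpace.single i (1 : ℝ)) := by
    ext j
    simp [Pi.single_apply]
    field_simp
  have hle : ∀ i, secondDifference g y (u i • s • EuclideanSpace.single i (1 : ℝ)) < c := fun i => by
    have hi : |u i| ≤ 1 := (PiLp.norm_apply_le u i).trans hu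
    refine ((secondDifference_smul_le hg y _ hi).trans ?_).trans_lt (h i)
    exact mul_le_of_le_one_left (secondDifference_nonneg hg _ _) hi
  have hsum := (convexOn_secondDifference hg y).map_sum_le (t := Finset.univ)
    (w := fun _ : Fin d => (1 / d : ℝ)) (p := fun i => u i • s • EuclideanSpace.single i (1 : ℝ))
    (fun _ _ => by positivity) (by simp [hd'.ne']) (fun _ _ => Set.mem_univ _)
  rw [e]
  refine hsum.trans_lt ?_
  have : Nonempty (Fin d) := ⟨⟨0, hd⟩⟩
  calc ∑ i : Fin d, (1 / d : ℝ) • secondDifference g y (u i • s • EuclideanSpace.single i (1 : ℝ))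
      < ∑ _i : Fin d, (1 / d : ℝ) * c :=
        Finset.sum_lt_sum_of_nonempty Finset.univ_nonempty fun i _ =>
          mul_lt_mul_of_pos_left (hle i) (by positivity)
    _ = c := by simp; field_simp

theorem exists_secondDifference_ge_of_mem_frontier {h : EuclideanSpace ℝ (Fin d) → ℝ}
    (hd : 0 < d) (hg : ConvexOn ℝ Set.univ g) (hh : ConvexOn ℝ Set.univ h)
    {F : Set (EuclideanSpace ℝ (Fin d))} (hF : IsClosed F)
    (hgh : ∀ x, Metric.infDist x F = g x - h x)
    {x : EuclideanSpace ℝ (Fin d)} (hx : x ∈ frontier F) :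
    ∃ i : Fin d, ∀ s : ℝ, 0 < s →
      1 / d * s ≤ secondDifference g x (s • EuclideanSpace.single i 1) := by
  have hd' : (0 : ℝ) < d := Nat.cast_pos.2 hd
  by_contra! hcon
  choose s hs hlt using hcon
  have : Nonempty (Fin d) := ⟨⟨0, hd⟩⟩
  obtain ⟨i₀, -, hi₀⟩ := Finset.exists_min_image Finset.univ s Finset.univ_nonempty
  set r := s i₀
  have hr : 0 < r := hs i₀
  have hlt' : ∀ i, secondDifference g x (r • EuclideanSpace.single i 1) < 1 / d * r := fun i => by
    have hle : r / s i ≤ 1 := (div_le_one (hs i)).2 (hi₀ i (Finset.mem_univ i))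
    have habs : |r / s i| = r / s i := abs_of_pos (div_pos hr (hs i))
    have h₁ := secondDifference_smul_le hg x (s i • EuclideanSpace.single i (1 : ℝ))
      (c := r / s i) (habs.trans_le hle)
    rw [smul_smul, div_mul_cancel₀ _ (hs i).ne', habs] at h₁
    refine h₁.trans_lt ((mul_lt_mul_of_pos_left (hlt i) (div_pos hr (hs i))).trans_eq ?_)
    have := (hs i).ne'
    field_simp
  have hcont := continuous_of_convexOn_univ hg
  have hev : ∀ᶠ y in nhds x, ∀ i,
      secondDifference g y (r • EuclideanSpace.single i 1) < 1 / d * r := by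
    refine Filter.eventually_all.2 fun i => ContinuousAt.eventually_lt ?_ continuousAt_const (hlt' i)
    unfold secondDifference
    fun_prop
  obtain ⟨δ, hδ, hball⟩ := Metric.eventually_nhds_iff.1 hev
  have hx' : x ∈ closure Fᶜ := (frontier_eq_closure_inter_closure (s := F) ▸ hx).2
  -- `δ / 2` keeps the nearest point `y` within `δ` of `x`; `r / d` makes `z - y` a contraction of
  -- `(r / d) • u`.
  obtain ⟨z, hzF, hz⟩ := Metric.mem_closure_iff.1 hx' (min (δ / 2) (r / d))
    (lt_min (half_pos hδ) (div_pos hr hd'))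
  have hxF : x ∈ F := hF.frontier_subset hx
  obtain ⟨y, hyF, hy⟩ := hF.exists_infDist_eq_dist ⟨x, hxF⟩ z
  have hzx : dist z y ≤ dist x z := by
    rw [← hy, dist_comm x z]
    exact Metric.infDist_le_dist_of_mem hxF
  have hyx : dist y x < δ := by
    have := dist_triangle y z x
    rw [dist_comm y z, dist_comm z x] at this
    have := hz.trans_le (min_le_left _ _)
    linarith
  have hzy : z ≠ y := fun hzy => hzF (hzy ▸ hyF)
  have hρ : 0 < ‖z - y‖ := norm_pos_iff.2 (sub_ne_zero.2 hzy)
  have hρr : ‖z - y‖ ≤ r / d := by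
    rw [← dist_eq_norm]
    exact hzx.trans (hz.trans_le (min_le_right _ _)).le
  have hbig : ‖z - y‖ ≤ secondDifference g y (z - y) := by
    have h₀ := secondDifference_nonneg hh y (z - y)
    have h₁ := hgh (y + (z - y))
    have h₂ := hgh (y - (z - y))
    have h₃ := hgh y
    rw [Metric.infDist_zero_of_mem hyF] at h₃
    have h₄ : 0 ≤ Metric.infDist (y - (z - y)) F := Metric.infDist_nonneg
    have h₅ : Metric.infDist (y + (z - y)) F = ‖z - y‖ := by
      rw [add_sub_cancel, hy, dist_eq_norm]
    unfold secondDifference at *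
    linarith
  set u := ‖z - y‖⁻¹ • (z - y)
  have hu : ‖u‖ = 1 := by
    simp only [u, norm_smul, norm_inv, norm_norm]
    exact inv_mul_cancel₀ hρ.ne'
  have hsmall := secondDifference_le_of_forall_single hg hd hu.le (hball hyx)
  have hrd : 0 < r / d := div_pos hr hd'
  have hc : |‖z - y‖ / (r / d)| = ‖z - y‖ / (r / d) := abs_of_pos (div_pos hρ hrd)
  have hscale := secondDifference_smul_le hg y ((r / d) • u) (c := ‖z - y‖ / (r / d))
    (hc.trans_le ((div_le_one hrd).2 hρr))
  have e : (‖z - y‖ / (r / d)) • (r / d) • u = z - y := by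
    rw [smul_smul, div_mul_cancel₀ _ hrd.ne', smul_smul, mul_inv_cancel₀ hρ.ne', one_smul]
  rw [e, hc] at hscale
  have := mul_lt_mul_of_pos_left hsmall (div_pos hρ hrd)
  have e₂ : ‖z - y‖ / (r / d) * (1 / d * r) = ‖z - y‖ := by field_simp
  linarith

/-- A supporting slope at `x` is bounded by the increments of `g` over the steps `±v`, which are
bounded above on the compact closure of `C`. -/
theorem finite_grid_slopes (hg : ConvexOn ℝ Set.univ g) (v : EuclideanSpace ℝ (Fin d))
    {C : Set (EuclideanSpace ℝ (Fin d))} (hC : Bornology.IsBounded C) {c : ℝ} (hc : 0 < c) :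
    {k : ℤ | (C ∩ supportedAlong g v (k * c)).Nonempty}.Finite := by
  have hcont := continuous_of_convexOn_univ hg
  have hK : IsCompact (closure C) := hC.isCompact_closure
  obtain ⟨a, ha⟩ := hK.bddAbove_image
    (f := fun x => g (x + (1 : ℝ) • v) - g x) (by fun_prop)
  obtain ⟨b, hb⟩ := hK.bddAbove_image
    (f := fun x => g (x + (-1 : ℝ) • v) - g x) (by fun_prop)
  refine (Set.finite_Icc ⌈-b / c⌉ ⌊a / c⌋).subset ?_
  rintro k ⟨x, hxC, hx⟩
  have h₁ := hx 1
  have h₂ := hx (-1)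
  have h₃ : g (x + (1 : ℝ) • v) - g x ≤ a := ha (Set.mem_image_of_mem _ (subset_closure hxC))
  have h₄ : g (x + (-1 : ℝ) • v) - g x ≤ b := hb (Set.mem_image_of_mem _ (subset_closure hxC))
  refine ⟨Int.ceil_le.2 ((div_le_iff₀ hc).2 ?_), Int.le_floor.2 ((le_div_iff₀ hc).2 ?_)⟩ <;>
    linarith

end Euclidean

theorem proposition4p7 (d : ℕ) (hd : 2 ≤ d) (F : Set (EuclideanSpace ℝ (Fin d)))
    (hF : F ∈ DCDistanceSets d) (C : Set (EuclideanSpace ℝ (Fin d)))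
    (hCF : C ⊆ frontier F) (hC : Bornology.IsBounded C) :
    ∃ S : Set (Set (EuclideanSpace ℝ (Fin d))),
      S.Finite ∧ (∀ A ∈ S, IsDCHypersurface A) ∧ C ⊆ ⋃₀ S := by
  rcases hF with rfl | ⟨-, hFc, g, h, hg, hh, hgh⟩
  · rw [frontier_empty] at hCF
    exact ⟨∅, Set.finite_empty, fun _ hA => hA.elim, hCF.trans (Set.empty_subset _)⟩
  have hd₀ : 0 < d := by omega
  have hη : (0 : ℝ) < 1 / d := one_div_pos.2 (Nat.cast_pos.2 hd₀)
  have hex : ∀ (i : Fin d) (k : ℤ), ∃ A, IsDCHypersurface A ∧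
      supportedAlong g (EuclideanSpace.single i 1) (k * (1 / d / 2)) ∩
        supportedAlong g (EuclideanSpace.single i 1) ((k + 1) * (1 / d / 2)) ⊆ A := fun i k =>
    exists_isDCHypersurface_superset hg (by simp)
      (mul_lt_mul_of_pos_right (lt_add_one _) (half_pos hη))
  choose A hA hsub using hex
  refine ⟨⋃ i : Fin d, A i '' {k : ℤ | (C ∩ supportedAlong g (EuclideanSpace.single i 1)
      (k * (1 / d / 2))).Nonempty},
    Set.finite_iUnion fun i => (finite_grid_slopes hg _ hC (half_pos hη)).image _, ?_, ?_⟩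
  · intro B hB
    obtain ⟨i, k, -, rfl⟩ := Set.mem_iUnion.1 hB
    exact hA i k
  · intro x hx
    obtain ⟨i, hi⟩ := exists_secondDifference_ge_of_mem_frontier hd₀ hg hh hFc hgh (hCF hx)
    obtain ⟨k, hk₁, hk₂⟩ := exists_grid_slope hg hη hi
    exact ⟨A i k, Set.mem_iUnion.2 ⟨i, k, ⟨x, hx, hk₁⟩, rfl⟩, hsub i k ⟨hk₁, hk₂⟩⟩
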